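/- Let $K$ be an ordered differential field with derivation $a\mapsto a'$; for $a\neq 0$ put $a^\dagger:=a'/a$. Let $C=\{a\in K: a'=0\}$, $\mathcal O=\{a: |a|\le c \text{ for some } c\in C^{>0}\}$, $\mathfrak{o}=\{a: |a|<c\text{ for all }c\in C^{>0}\}$. Assume that $K$ is an $H$-field, that is, $\mathcal O=C+\mathfrak{o}$, and $a'>0$ whenever $a>C$. Let $v:K\to\Gamma\cup\{\infty\}$, with $\Gamma=v(K^\times)$, be the valuation with valuation ring $\mathcal O$, and write $f\asymp g$ for $vf=vg$, and $f\succ g$ for $vf<vg$. Put $(\Gamma^{\neq})'=\{v(g'): g\in K^\times,\ vg\ne 0\}$ and $(\Gamma^{>})'=\{v(g'): g\in K^\times,\ vg>0\}$. Assume that $K$ is real closed and has asymptotic integration, that is, $\Gamma=(\Gamma^{\neq})'$. For each $f\succ 1$ in $K$ choose $\mathrm{L}f\succ 1$ in $K$ with $(\mathrm{L}f)'\asymp f^\dagger$. Choose elements $\ell_\rho\succ 1$ of $K$, indexed by the ordinals $\rho$ less than some infinite limit ordinal $\nu$, by transfinite recursion: $\ell_0\succ 1$ is arbitrary; $\ell_{\rho+1}=\mathrm{L}(\ell_\rho)$;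 if $\mu$ is an infinite limit ordinal and all $\ell_\rho$ with $\rho<\mu$ have been chosen, then $\ell_\mu\succ1$ is such that $\ell_\rho\succ\ell_\mu$ for all $\rho<\mu$, if there is such an element, and otherwise the recursion stops with $\nu=\mu$. Put $\lambda_\rho:=-\ell_\rho^{\dagger\dagger}$. Such choices are possible, and for any such choices the sequence $(\lambda_\rho)_{\rho<\nu}$ is a pseudo-cauchy sequence (for some $\rho_0<\nu$, $v(\lambda_\tau-\lambda_\sigma)>v(\lambda_\sigma-\lambda_\rho)$ whenever $\rho_0<\rho<\sigma<\tau<\nu$), it is jammed (with $\gamma_\rho:=v(\lambda_{\rho+1}-\lambda_\rho)$, for every $\delta>0$ in $\Gamma$ there is an index $\rho_0$ such that $|\gamma_\mu-\gamma_\rho|<\delta$ whenever $\mu>\rho>\rho_0$), and the following two conditions are equivalent: (1) for every $a\in K$ there is $b\in K^{\times}$ such that $v(a-b^\dagger)\le vb$, and $vb<\gamma$ for all $\gamma\in(\Gamma^{>})'$; (2) $(\lambda_\rho)$ has no pseudolimit in $K$, that is, there is no $x\in K$ such that $v(x-\lambda_\rho)$ is eventually strictly increasing in $\rho$. -/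

import Mathlib

open scoped Differential

universe u

namespace HField

section Basic

variable (K : Type u) [Field K] [LinearOrder K] [IsStrictOrderedRing K] [Differential K]

/-- The valuation ring `𝒪` of an ordered differential field: the convex hull of the constant field
`C = {c | c′ = 0}`, that is, the set of all `a` with `|a| ≤ c` for some constant `c > 0`. -/
def ring : ValuationSubring K where
  carrier := {a | ∃ c : K, c′ = 0 ∧ 0 < c ∧ |a| ≤ c}
  mul_mem' := by
    rintro a b ⟨c, hc, hc0, hac⟩ ⟨d, hd, hd0, hbd⟩
    refine ⟨c * d, by simp [hc, hd], mul_pos hc0 hd0, ?_⟩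
    rw [abs_mul]
    exact mul_le_mul hac hbd (abs_nonneg b) hc0.le
  one_mem' := ⟨1, by simp, one_pos, by simp⟩
  add_mem' := by
    rintro a b ⟨c, hc, hc0, hac⟩ ⟨d, hd, hd0, hbd⟩
    exact ⟨c + d, by simp [hc, hd], add_pos hc0 hd0, (abs_add_le a b).trans (add_le_add hac hbd)⟩
  zero_mem' := ⟨1, by simp, one_pos, by simp⟩
  neg_mem' := by
    rintro a ⟨c, hc, hc0, hac⟩
    exact ⟨c, hc, hc0, by rwa [abs_neg]⟩
  mem_or_inv_mem' := by
    intro a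
    rcases le_total |a| 1 with h | h
    · exact Or.inl ⟨1, by simp, one_pos, h⟩
    · exact Or.inr ⟨1, by simp, one_pos, by rw [abs_inv]; exact inv_le_one_of_one_le₀ h⟩

/-- The maximal ideal `𝓸` of `𝒪`: all `a` with `|a| < c` for every constant `c > 0`. -/
def small : Set K := {a | ∀ c : K, c′ = 0 → 0 < c → |a| < c}

/-- An ordered differential field `K` is an `H`-field if `𝒪 = C + 𝓸` and `a > C → a′ > 0`. -/
structure IsHField : Prop where
  mem_ring_iff : ∀ a : K, a ∈ ring K ↔ ∃ c ε : K, c′ = 0 ∧ ε ∈ small K ∧ a = c + ε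
  deriv_pos : ∀ a : K, (∀ c : K, c′ = 0 → c < a) → 0 < a′

/-- The value group `Γ` of `K` with a largest element `∞ = ⊤` added, written additively.
Mathlib's value group of a valuation ring is multiplicative, with a smallest element `0 = v 0`;
passing to `Additive` and reversing the order gives the additive (Krull) convention. -/
abbrev Value : Type u := (Additive (ring K).ValueGroup)ᵒᵈ

end Basic

section Valuation

variable {K : Type u} [Field K] [LinearOrder K] [IsStrictOrderedRing K] [Differential K]

/-- The (additive) valuation `v : K → Γ ∪ {∞}` with valuation ring `𝒪`. In terms of it:
`f ≼ g` is `v g ≤ v f`, `f ≺ g` is `v g < v f`, `f ≍ g` is `v f = v g`, and so `f ≻ 1` is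
`v f < 0`. -/
noncomputable def v : AddValuation K (Value K) := (ring K).valuation.toAddValuation

variable (K) in
/-- `(Γ^≠)'`, the image of `Γ \ {0}` under the map `v g ↦ v g′` induced by the derivation. -/
def derivNe : Set (Value K) := {γ | ∃ g : K, g ≠ 0 ∧ v g ≠ 0 ∧ γ = v g′}

variable (K) in
/-- `(Γ^>)'`, the image of the positive part of `Γ` under the map `v g ↦ v g′`. -/
def derivPos : Set (Value K) := {γ | ∃ g : K, g ≠ 0 ∧ 0 < v g ∧ γ = v g′}

variable (K) in
/-- Asymptotic integration: `Γ = (Γ^≠)'`. -/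
def HasAsymptoticIntegration : Prop := {γ : Value K | γ ≠ ⊤} = derivNe K

/-- A choice function for substitutes of logarithms: for each `f ≻ 1` it gives `L f ≻ 1` with
`(L f)′ ≍ f†`. -/
def IsLogSubstitute (L : K → K) : Prop :=
  ∀ f : K, v f < 0 → v (L f) < 0 ∧ v (L f)′ = v (Differential.logDeriv f)

/-- `(ℓ_ρ)_{ρ < ν}` is a sequence of iterated logarithms obtained from `L` by transfinite recursion,
continued as long as possible. Only the values `ℓ ρ` with `ρ < ν` are relevant. -/
structure IsLogSequence (L : K → K) (ν : Ordinal.{u}) (ℓ : Ordinal.{u} → K) : Prop where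
  /-- The index set consists of the ordinals below an infinite limit ordinal. -/
  isSuccLimit : Order.IsSuccLimit ν
  /-- All `ℓ_ρ ≻ 1`. -/
  infinite : ∀ ρ < ν, v (ℓ ρ) < 0
  /-- Successor step: `ℓ_{ρ+1} = L ℓ_ρ`. -/
  succ : ∀ ρ < ν, ℓ (ρ + 1) = L (ℓ ρ)
  /-- Limit step: `ℓ_ρ ≻ ℓ_μ` for all `ρ < μ`, if `μ` is an infinite limit ordinal. -/
  limit : ∀ μ < ν, Order.IsSuccLimit μ → ∀ ρ < μ, v (ℓ ρ) < v (ℓ μ)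
  /-- The recursion stops at `ν`: there is no `f ≻ 1` with `ℓ_ρ ≻ f` for all `ρ < ν`. -/
  stops : ¬ ∃ f : K, v f < 0 ∧ ∀ ρ < ν, v (ℓ ρ) < v f

/-- `λ_ρ = -ℓ_ρ††`. -/
noncomputable def lam (ℓ : Ordinal.{u} → K) (ρ : Ordinal.{u}) : K :=
  -Differential.logDeriv (Differential.logDeriv (ℓ ρ))

/-- `(a_ρ)_{ρ < ν}` is a pseudo-cauchy sequence: for some `ρ₀ < ν` one has
`v (a_τ - a_σ) > v (a_σ - a_ρ)` whenever `ρ₀ < ρ < σ < τ < ν`. -/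
def IsPCSequence (ν : Ordinal.{u}) (a : Ordinal.{u} → K) : Prop :=
  ∃ ρ₀ < ν, ∀ ρ σ τ, ρ₀ < ρ → ρ < σ → σ < τ → τ < ν → v (a σ - a ρ) < v (a τ - a σ)

/-- `x` is a pseudolimit of `(a_ρ)_{ρ < ν}`: `v (x - a_ρ)` is eventually strictly increasing. -/
def IsPseudolimit (ν : Ordinal.{u}) (a : Ordinal.{u} → K) (x : K) : Prop :=
  ∃ ρ₀ < ν, ∀ ρ σ, ρ₀ < ρ → ρ < σ → σ < ν → v (x - a ρ) < v (x - a σ)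

/-- `(a_ρ)_{ρ < ν}` is jammed: with `γ_ρ = v (a_{ρ+1} - a_ρ)`, for each `δ > 0` in `Γ` there is an
index `ρ₀` with `|γ_μ - γ_ρ| < δ` for all `μ > ρ > ρ₀`. -/
def IsJammed (ν : Ordinal.{u}) (a : Ordinal.{u} → K) : Prop :=
  ∀ δ : Value K, 0 < δ → δ ≠ ⊤ → ∃ ρ₀ < ν, ∀ ρ μ, ρ₀ < ρ → ρ < μ → μ < ν →
    v (a (μ + 1) - a μ) < v (a (ρ + 1) - a ρ) + δ ∧
    v (a (ρ + 1) - a ρ) < v (a (μ + 1) - a μ) + δ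

end Valuation

end HField

/-! Everything rests on one inequality: if `f ≻ 1` and `ε ≺ 1`, then `f† ≻ ε′`
(`IsHField.v_logDeriv_lt_v_deriv`). It implies that `u† ≺ f†` when `u ≍ 1`, and that `b ≻ f†` forces
`(f†/b)† ≺ b` (`IsHField.v_lt_v_logDeriv_div`).

As `ℓ_{ρ+1}′ ≍ ℓ_ρ†`, the difference `λ_{ρ+1} - λ_ρ` is `ℓ_{ρ+1}†` up to the logarithmic derivative
of a unit; more generally `λ_σ - λ_ρ ≍ ℓ_{ρ+1}†` for all `σ > ρ` (`IsLogSequence.v_lam_sub`). The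
pseudo-cauchy property follows because `v(ℓ_ρ†)` increases, and jammedness because every `g ≻ 1`
dominates some `ℓ_ρ`, the recursion having stopped.

For the equivalence, condition (1) at `a` is matched with `-a` as candidate pseudolimit. The `ℓ_ρ†`
are the test elements: if (1) fails at `a`, then `b = ℓ_ρ†` gives `-a - λ_ρ ≺ ℓ_ρ†` for every `ρ`,
so `-a` is a pseudolimit. Conversely, near a pseudolimit `x`, any admissible `b` dominates some
`ℓ_ρ†`, and then `-x - b† ≺ b`. -/

namespace HField

section Valuation

variable {K : Type u} [Field K] [LinearOrder K] [IsStrictOrderedRing K] [Differential K]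

/-! ### The valuation in terms of the ordering -/

lemma v_nonneg_iff {f : K} : 0 ≤ v f ↔ f ∈ ring K :=
  (ring K).valuation_le_one_iff f

lemma v_neg_iff {f : K} : v f < 0 ↔ ∀ c : K, c′ = 0 → 0 < c → c < |f| := by
  rw [← not_le, v_nonneg_iff]
  change ¬ (∃ c : K, c′ = 0 ∧ 0 < c ∧ |f| ≤ c) ↔ _
  push Not
  rfl

lemma v_ne_top {f : K} (hf : f ≠ 0) : v f ≠ ⊤ := (AddValuation.ne_top_iff v).2 hf

lemma ne_zero_of_v_neg {f : K} (hf : v f < 0) : f ≠ 0 := by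
  rintro rfl
  simp at hf

lemma v_lt_v_iff_div {f g : K} (hg : g ≠ 0) : v g < v f ↔ 0 < v (f / g) := by
  conv_lhs => rw [← div_mul_cancel₀ f hg, AddValuation.map_mul]
  nth_rw 1 [← zero_add (v g)]
  exact add_lt_add_iff_left_of_ne_top (v_ne_top hg)

lemma v_le_v_iff_div {f g : K} (hg : g ≠ 0) : v g ≤ v f ↔ 0 ≤ v (f / g) := by
  conv_lhs => rw [← div_mul_cancel₀ f hg, AddValuation.map_mul]
  nth_rw 1 [← zero_add (v g)]
  exact add_le_add_iff_left_of_ne_top (v_ne_top hg)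

lemma v_le_of_abs_le {f g : K} (h : |f| ≤ |g|) : v g ≤ v f := by
  rcases eq_or_ne g 0 with rfl | hg
  · have : f = 0 := by simpa using h
    simp [this]
  rw [v_le_v_iff_div hg, v_nonneg_iff]
  refine ⟨1, by simp, one_pos, ?_⟩
  rw [abs_div]
  exact div_le_one_of_le₀ h (abs_nonneg g)

omit [LinearOrder K] [IsStrictOrderedRing K] in
lemma deriv_inv_of_deriv_eq_zero {c : K} (hc : c′ = 0) : (c⁻¹)′ = 0 := by
  rw [Derivation.leibniz_inv, hc, smul_zero]

lemma v_pos_iff {f : K} : 0 < v f ↔ f ∈ small K := by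
  constructor
  · intro h c hc hc0
    by_contra! hcf
    have hf : f ≠ 0 := by
      rintro rfl
      simp [hc0.not_ge] at hcf
    have : 0 ≤ v f⁻¹ := by
      rw [v_nonneg_iff]
      refine ⟨c⁻¹, deriv_inv_of_deriv_eq_zero hc, inv_pos.2 hc0, ?_⟩
      rw [abs_inv]
      exact inv_anti₀ hc0 hcf
    have h2 : v f + v f⁻¹ = 0 := by
      rw [← AddValuation.map_mul, mul_inv_cancel₀ hf, AddValuation.map_one]
    exact (add_pos_of_pos_of_nonneg h this).ne' h2
  · intro h
    rcases eq_or_ne f 0 with rfl | hf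
    · simp
    have h1 : v f⁻¹ < 0 := by
      rw [v_neg_iff]
      intro c hc hc0
      rw [abs_inv, lt_inv_comm₀ hc0 (abs_pos.2 hf)]
      exact h _ (deriv_inv_of_deriv_eq_zero hc) (inv_pos.2 hc0)
    have h2 : v f + v f⁻¹ = 0 := by
      rw [← AddValuation.map_mul, mul_inv_cancel₀ hf, AddValuation.map_one]
    by_contra! h3
    have h4 : v f + v f⁻¹ ≤ v f⁻¹ := by simpa using add_le_add_left h3 (v f⁻¹)
    exact (h4.trans_lt h1).ne h2

lemma v_inv_neg {f : K} (hf : f ≠ 0) (h : 0 < v f) : v f⁻¹ < 0 := by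
  have h1 := (v_lt_v_iff_div (f := 1) (g := f⁻¹) (inv_ne_zero hf)).2 (by simpa using h)
  simpa using h1

lemma v_inv_pos {f : K} (h : v f < 0) : 0 < v f⁻¹ := by
  have h1 := (v_lt_v_iff_div (f := 1) (ne_zero_of_v_neg h)).1 (by simpa using h)
  simpa using h1

lemma v_const {c : K} (hc : c′ = 0) (hc0 : c ≠ 0) : v c = 0 := by
  have key : ∀ d : K, d′ = 0 → d ≠ 0 → 0 ≤ v d := by
    intro d hd hd0
    rw [v_nonneg_iff]
    refine ⟨|d|, ?_, abs_pos.2 hd0, le_rfl⟩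
    rcases abs_choice d with h | h <;> rw [h] <;> simp [hd]
  refine le_antisymm ?_ (key c hc hc0)
  by_contra! h
  exact (key c⁻¹ (deriv_inv_of_deriv_eq_zero hc) (inv_ne_zero hc0)).not_gt (v_inv_neg hc0 h)

omit [LinearOrder K] [IsStrictOrderedRing K] in
lemma logDeriv_neg (f : K) : Differential.logDeriv (-f) = Differential.logDeriv f := by
  simp [Differential.logDeriv, neg_div_neg_eq]

lemma logDeriv_inv (f : K) : Differential.logDeriv f⁻¹ = -Differential.logDeriv f := by
  rcases eq_or_ne f 0 with rfl | hf
  · simp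
  have := Differential.logDeriv_div (1 : K) f one_ne_zero hf
  simpa using this

lemma v_logDeriv_add {f : K} (hf : f ≠ 0) : v (Differential.logDeriv f) + v f = v f′ := by
  rw [← AddValuation.map_mul, Differential.logDeriv, div_mul_cancel₀ _ hf]

/-! ### Asymptotics of derivatives and logarithmic derivatives -/

namespace IsHField

variable (hH : IsHField K)
include hH

lemma deriv_pos_of_v_neg {f : K} (hf : v f < 0) (h0 : 0 < f) : 0 < f′ := by
  refine hH.deriv_pos f fun c hc => ?_
  rcases le_or_gt c 0 with h | h
  · exact h.trans_lt h0
  · simpa [abs_of_pos h0] using v_neg_iff.1 hf c hc h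

/-- Logarithmic derivatives of infinite elements dominate derivatives of infinitesimals. -/
lemma v_logDeriv_lt_v_deriv {f ε : K} (hf : v f < 0) (hε : 0 < v ε) :
    v (Differential.logDeriv f) < v ε′ := by
  wlog h0 : 0 < f generalizing f
  · have hf0 := ne_zero_of_v_neg hf
    rw [← logDeriv_neg]
    exact this (by simpa using hf) (by
      have := lt_of_le_of_ne (not_lt.1 h0) hf0
      linarith)
  have hf' := hH.deriv_pos_of_v_neg hf h0
  have hl : 0 < Differential.logDeriv f := div_pos hf' h0
  rw [v_lt_v_iff_div hl.ne', v_pos_iff]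
  -- The element `f * (2 * c + η)` is positive and infinite, so its derivative is positive; then
  -- bound `2 * c + η < 3 * c`. Using `η = ε` and `η = -ε` bounds `|ε′|` by a constant multiple of
  -- `f†`.
  have key : ∀ η : K, η ∈ small K → ∀ c : K, c′ = 0 → 0 < c → 0 < f′ * (3 * c) + f * η′ := by
    intro η hη c hc hc0
    have hη' := abs_lt.1 (hη c hc hc0)
    have hu : v (2 * c + η) ≤ 0 := by
      rw [← v_const hc hc0.ne']
      refine v_le_of_abs_le ?_
      rw [abs_of_pos hc0, abs_of_pos (by linarith)]
      linarith
    have h1 : v (f * (2 * c + η)) < 0 := by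
      rw [AddValuation.map_mul]
      exact add_neg_of_neg_of_nonpos hf hu
    have h2 := hH.deriv_pos_of_v_neg h1 (mul_pos h0 (by linarith))
    have h3 : (2 * c + η)′ = η′ := by
      rw [map_add, two_mul, map_add, hc]; simp
    rw [Derivation.leibniz, h3, smul_eq_mul, smul_eq_mul] at h2
    nlinarith
  intro c hc hc0
  have hε' := v_pos_iff.1 hε
  have hc3 : (c / 3)′ = 0 := by
    have h : (3 : K) * (c / 3) = c := by ring
    have h3 : ((3 : K))′ = 0 := by
      have := Derivation.map_natCast (Differential.deriv (R := K)) 3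
      exact_mod_cast this
    have := congrArg (fun x : K => x′) h
    simp only [Derivation.leibniz, h3, hc, smul_eq_mul, mul_zero, add_zero] at this
    simpa using this
  have h1 := key ε hε' (c / 3) hc3 (by positivity)
  have h2 := key (-ε) (v_pos_iff.1 (by simpa using hε)) (c / 3) hc3 (by positivity)
  rw [map_neg] at h2
  rw [abs_div, abs_of_pos hl, div_lt_iff₀ hl, Differential.logDeriv, mul_div_assoc', lt_div_iff₀ h0]
  rcases abs_choice ε′ with h | h <;> rw [h] <;> linarith

/-- Logarithmic derivatives of infinite elements dominate derivatives of bounded elements. -/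
lemma v_logDeriv_lt_v_deriv_of_nonneg {f u : K} (hf : v f < 0) (hu : 0 ≤ v u) :
    v (Differential.logDeriv f) < v u′ := by
  obtain ⟨c, ε, hc, hε, rfl⟩ := (hH.mem_ring_iff u).1 (v_nonneg_iff.1 hu)
  rw [map_add, hc, zero_add]
  exact hH.v_logDeriv_lt_v_deriv hf (v_pos_iff.2 hε)

lemma v_logDeriv_lt_v_logDeriv_of_eq_zero {f u : K} (hf : v f < 0) (hu : v u = 0) :
    v (Differential.logDeriv f) < v (Differential.logDeriv u) := by
  have hu0 : u ≠ 0 := by rintro rfl; simp at hu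
  have h := v_logDeriv_add hu0
  rw [hu, add_zero] at h
  rw [h]
  exact hH.v_logDeriv_lt_v_deriv_of_nonneg hf hu.ge

lemma logDeriv_ne_zero {f : K} (hf : v f < 0) : Differential.logDeriv f ≠ 0 := by
  intro h
  have := hH.v_logDeriv_lt_v_deriv (ε := 0) hf (by simp)
  simp [h] at this

lemma v_deriv_lt_v_logDeriv {f : K} (hf : v f < 0) : v f′ < v (Differential.logDeriv f) := by
  rw [← v_logDeriv_add (ne_zero_of_v_neg hf)]
  nth_rw 2 [← add_zero (v (Differential.logDeriv f))]
  exact (add_lt_add_iff_right_of_ne_top (v_ne_top (hH.logDeriv_ne_zero hf))).2 hf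

/-- Write `f† = g† + (f/g)†` with `f, g > 0`. If `f ≻ g`, both summands are positive, so no
cancellation occurs; if `f ≍ g`, the second is negligible. -/
lemma v_logDeriv_mono {f g : K} (hg : v g < 0) (hfg : v f ≤ v g) :
    v (Differential.logDeriv f) ≤ v (Differential.logDeriv g) := by
  wlog hf0 : 0 < f generalizing f
  · have hne := ne_zero_of_v_neg (hfg.trans_lt hg)
    rw [← logDeriv_neg f]
    exact this (by simpa using hfg) (by
      have := lt_of_le_of_ne (not_lt.1 hf0) hne
      linarith)
  wlog hg0 : 0 < g generalizing g
  · have hne := ne_zero_of_v_neg hg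
    rw [← logDeriv_neg g]
    exact this (by simpa using hg) (by simpa using hfg) (by
      have := lt_of_le_of_ne (not_lt.1 hg0) hne
      linarith)
  have hmul : f = g * (f / g) := by field_simp
  have hd : Differential.logDeriv f = Differential.logDeriv g + Differential.logDeriv (f / g) := by
    rw [← Differential.logDeriv_mul _ _ hg0.ne' (div_pos hf0 hg0).ne', ← hmul]
  rcases hfg.lt_or_eq with h | h
  · have hq : v (f / g) < 0 := by
      have := (v_lt_v_iff_div hf0.ne').1 h
      rw [← inv_div]
      exact v_inv_neg (div_pos hg0 hf0).ne' this
    refine v_le_of_abs_le ?_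
    have h1 := hH.deriv_pos_of_v_neg hg hg0
    have h2 := hH.deriv_pos_of_v_neg hq (div_pos hf0 hg0)
    have h3 : 0 < Differential.logDeriv g := div_pos h1 hg0
    have h4 : 0 < Differential.logDeriv (f / g) := div_pos h2 (div_pos hf0 hg0)
    rw [hd, abs_of_pos h3, abs_of_pos (add_pos h3 h4)]
    linarith
  · have hq : v (f / g) = 0 := by
      refine le_antisymm ?_ ((v_le_v_iff_div hg0.ne').1 h.ge)
      by_contra! h5
      exact ((v_lt_v_iff_div hg0.ne').2 h5).ne h.symm
    rw [hd, AddValuation.map_add_eq_of_lt_left v (hH.v_logDeriv_lt_v_logDeriv_of_eq_zero hg hq)]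

/-- Here `y = f†/b` is infinitesimal, so `y′ ≺ f† = b * y`; cancel `y`. -/
lemma v_lt_v_logDeriv_div {f b : K} (hf : v f < 0) (hb : b ≠ 0)
    (h : v b < v (Differential.logDeriv f)) :
    v b < v (Differential.logDeriv (Differential.logDeriv f / b)) := by
  set y := Differential.logDeriv f / b with hy
  have hy0 : y ≠ 0 := div_ne_zero (hH.logDeriv_ne_zero hf) hb
  have h1 := hH.v_logDeriv_lt_v_deriv hf ((v_lt_v_iff_div hb).1 h)
  rw [← hy, ← v_logDeriv_add hy0, show Differential.logDeriv f = b * y by rw [hy]; field_simp,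
    AddValuation.map_mul] at h1
  exact (add_lt_add_iff_left_of_ne_top (v_ne_top hy0)).1 h1

lemma v_logDeriv_lt_of_mem_derivPos {f : K} (hf : v f < 0) {γ : Value K} (hγ : γ ∈ derivPos K) :
    v (Differential.logDeriv f) < γ := by
  obtain ⟨g, -, hg, rfl⟩ := hγ
  exact hH.v_logDeriv_lt_v_deriv hf hg

omit hH in
-- An asymptotic integral of `b` cannot be infinitesimal, since `v b` lies below `(Γ^>)'`.
lemma exists_v_eq_v_deriv (hK : HasAsymptoticIntegration K) {b : K} (hb : b ≠ 0)
    (h : ∀ γ ∈ derivPos K, v b < γ) : ∃ g : K, v g < 0 ∧ v g′ = v b := by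
  have : v b ∈ derivNe K := hK ▸ v_ne_top hb
  obtain ⟨g, hg0, hg, hbg⟩ := this
  refine ⟨g, lt_of_le_of_ne (not_lt.1 fun hpos => ?_) hg, hbg.symm⟩
  exact (h _ ⟨g, hg0, hpos, rfl⟩).ne hbg

lemma exists_isLogSubstitute (hK : HasAsymptoticIntegration K) :
    ∃ L : K → K, IsLogSubstitute L := by
  have (f : K) : ∃ g : K, v f < 0 → v g < 0 ∧ v g′ = v (Differential.logDeriv f) := by
    by_cases hf : v f < 0
    · obtain ⟨g, hg⟩ := exists_v_eq_v_deriv hK (hH.logDeriv_ne_zero hf)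
        fun γ hγ => hH.v_logDeriv_lt_of_mem_derivPos hf hγ
      exact ⟨g, fun _ => hg⟩
    · exact ⟨0, fun h => (hf h).elim⟩
  choose L hL using this
  exact ⟨L, hL⟩

/-- If `L f ≽ f`, then `(L f)† ≽ f† ≍ (L f)′`, whereas `g′ ≻ g†` for every `g ≻ 1`. -/
lemma v_lt_v_logSubstitute {L : K → K} (hL : IsLogSubstitute L) {f : K} (hf : v f < 0) :
    v f < v (L f) := by
  obtain ⟨h1, h2⟩ := hL f hf
  by_contra! h
  exact ((hH.v_logDeriv_mono hf h).trans_eq h2.symm).not_gt (hH.v_deriv_lt_v_logDeriv h1)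

end IsHField

/-! ### Existence of sequences of iterated logarithms -/

lemma exists_v_neg (hK : HasAsymptoticIntegration K) : ∃ f : K, v f < 0 := by
  have : (0 : Value K) ∈ derivNe K := by
    rw [← hK]
    simp
  obtain ⟨g, hg0, hg, -⟩ := this
  rcases hg.lt_or_gt with h | h
  · exact ⟨g, h⟩
  · exact ⟨g⁻¹, v_inv_neg hg0 h⟩

open Classical in
/-- The sequence of iterated logarithms starting with `f`, continued by `0` once it has stopped. -/
noncomputable def logSeq (L : K → K) (f : K) (ρ : Ordinal.{u}) : K :=
  SuccOrder.limitRecOn ρ (fun _ _ => f) (fun _ _ g => L g) fun μ _ l =>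
    if h : ∃ g : K, v g < 0 ∧ ∀ ρ (hρ : ρ < μ), v (l ρ hρ) < v g then h.choose else 0

lemma logSeq_zero (L : K → K) (f : K) : logSeq L f 0 = f :=
  SuccOrder.limitRecOn_isMin _ _ _ isMin_bot

lemma logSeq_add_one (L : K → K) (f : K) (ρ : Ordinal.{u}) :
    logSeq L f (ρ + 1) = L (logSeq L f ρ) :=
  SuccOrder.limitRecOn_succ_of_not_isMax _ _ _ (not_isMax ρ)

lemma logSeq_limit (L : K → K) (f : K) {μ : Ordinal.{u}} (hμ : Order.IsSuccLimit μ)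
    (h : ∃ g : K, v g < 0 ∧ ∀ ρ < μ, v (logSeq L f ρ) < v g) :
    v (logSeq L f μ) < 0 ∧ ∀ ρ < μ, v (logSeq L f ρ) < v (logSeq L f μ) := by
  have : logSeq L f μ = h.choose := by
    rw [logSeq, SuccOrder.limitRecOn_of_isSuccLimit _ _ _ hμ]
    exact dif_pos h
  rw [this]
  exact h.choose_spec

/-- If the iterated logarithms do not stop before `ν`, they are infinite and strictly decreasing in
the dominance order. -/
lemma logSeq_infinite (hH : IsHField K) {L : K → K} (hL : IsLogSubstitute L) {f : K} (hf : v f < 0)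
    {ν : Ordinal.{u}} (hν : ∀ μ < ν, Order.IsSuccLimit μ →
      ∃ g : K, v g < 0 ∧ ∀ ρ < μ, v (logSeq L f ρ) < v g) :
    ∀ σ < ν, v (logSeq L f σ) < 0 ∧ ∀ ρ < σ, v (logSeq L f ρ) < v (logSeq L f σ) := by
  intro σ
  induction σ using Ordinal.limitRecOn with
  | zero => exact fun _ => ⟨by rwa [logSeq_zero], fun ρ hρ => (not_lt_zero hρ).elim⟩
  | add_one σ ih =>
    intro hσ
    obtain ⟨h1, h2⟩ := ih ((Order.lt_add_one_iff.2 le_rfl).trans hσ)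
    rw [logSeq_add_one]
    refine ⟨(hL _ h1).1, fun ρ hρ => ?_⟩
    have h3 := hH.v_lt_v_logSubstitute hL h1
    rcases (Order.lt_add_one_iff.1 hρ).lt_or_eq with h | rfl
    · exact (h2 ρ h).trans h3
    · exact h3
  | limit σ hσ ih => exact fun h => logSeq_limit L f hσ (hν σ h hσ)

lemma exists_isLogSequence (hH : IsHField K) {L : K → K} (hL : IsLogSubstitute L) {f : K}
    (hf : v f < 0) : ∃ ν, IsLogSequence L ν (logSeq L f) := by
  have hex : ∃ ν : Ordinal.{u}, Order.IsSuccLimit ν ∧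
      ¬ ∃ g : K, v g < 0 ∧ ∀ ρ < ν, v (logSeq L f ρ) < v g := by
    by_contra! h
    -- A recursion that never stops would inject all ordinals of universe `u` into `K : Type u`.
    refine not_injective_of_ordinal (logSeq L f) fun ρ σ hρσ => ?_
    have key (ρ σ : Ordinal.{u}) (h1 : ρ < σ) : logSeq L f ρ ≠ logSeq L f σ := fun h2 =>
      ((logSeq_infinite hH hL hf (ν := σ + 1) (fun μ _ hμ => h μ hμ) σ
        (Order.lt_add_one_iff.2 le_rfl)).2 ρ h1).ne (by rw [h2])
    by_contra hne
    rcases lt_or_gt_of_ne hne with h1 | h1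
    · exact key _ _ h1 hρσ
    · exact key _ _ h1 hρσ.symm
  obtain ⟨ν, ⟨h1, h2⟩, hmin⟩ := WellFounded.has_min
    (wellFounded_lt (α := Ordinal.{u})) {ν | Order.IsSuccLimit ν ∧
      ¬ ∃ g : K, v g < 0 ∧ ∀ ρ < ν, v (logSeq L f ρ) < v g} hex
  have key := logSeq_infinite hH hL hf (ν := ν) fun μ hμ hlim => by
    by_contra hno
    exact hmin μ ⟨hlim, hno⟩ hμ
  exact ⟨ν, h1, fun ρ hρ => (key ρ hρ).1, fun ρ _ => logSeq_add_one L f ρ,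
    fun μ hμ _ => (key μ hμ).2, h2⟩

/-! ### The sequence `(λ_ρ)` and its pseudolimits -/

namespace IsLogSequence

variable {L : K → K} {ν : Ordinal.{u}} {l : Ordinal.{u} → K} (hl : IsLogSequence L ν l)
include hl

lemma add_one_lt {ρ : Ordinal.{u}} (hρ : ρ < ν) : ρ + 1 < ν := by
  simpa using hl.isSuccLimit.succ_lt hρ

lemma exists_v_le {g : K} (hg : v g < 0) : ∃ ρ < ν, v g ≤ v (l ρ) := by
  by_contra! h
  exact hl.stops ⟨g, hg, h⟩

variable (hH : IsHField K) (hL : IsLogSubstitute L)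
include hH hL

lemma v_strictMono {ρ σ : Ordinal.{u}} (hρσ : ρ < σ) (hσ : σ < ν) : v (l ρ) < v (l σ) := by
  induction σ using Ordinal.limitRecOn with
  | zero => exact (not_lt_zero hρσ).elim
  | add_one σ ih =>
    have h0 := (Order.lt_add_one_iff.2 le_rfl).trans hσ
    rw [hl.succ σ h0]
    have h3 := hH.v_lt_v_logSubstitute hL (hl.infinite σ h0)
    rcases (Order.lt_add_one_iff.1 hρσ).lt_or_eq with h | rfl
    · exact (ih h h0).trans h3
    · exact h3
  | limit σ h _ => exact hl.limit σ hσ h ρ hρσ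

lemma v_mono {ρ σ : Ordinal.{u}} (hρσ : ρ ≤ σ) (hσ : σ < ν) : v (l ρ) ≤ v (l σ) := by
  rcases hρσ.lt_or_eq with h | rfl
  · exact (hl.v_strictMono hH hL h hσ).le
  · rfl

omit hH in
lemma v_deriv_succ {ρ : Ordinal.{u}} (hρ : ρ < ν) :
    v (l (ρ + 1))′ = v (Differential.logDeriv (l ρ)) := by
  rw [hl.succ ρ hρ]
  exact (hL _ (hl.infinite ρ hρ)).2

lemma v_logDeriv_strictMono {ρ σ : Ordinal.{u}} (hρσ : ρ < σ) (hσ : σ < ν) :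
    v (Differential.logDeriv (l ρ)) < v (Differential.logDeriv (l σ)) := by
  have hρ := hρσ.trans hσ
  rw [← hl.v_deriv_succ hL hρ]
  exact (hH.v_deriv_lt_v_logDeriv (hl.infinite _ (hl.add_one_lt hρ))).trans_le
    (hH.v_logDeriv_mono (hl.infinite σ hσ)
      (hl.v_mono hH hL (Order.add_one_le_iff.2 hρσ) hσ))

/-- With `u = ℓ_{ρ+1}′ / ℓ_ρ† ≍ 1`, the difference equals `ℓ_{ρ+1}† - u†`, and `u† ≺ ℓ_{ρ+1}†`. -/
lemma v_lam_succ_sub {ρ : Ordinal.{u}} (hρ : ρ < ν) :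
    v (lam l (ρ + 1) - lam l ρ) = v (Differential.logDeriv (l (ρ + 1))) := by
  have hρ1 := hl.add_one_lt hρ
  have h0 := hl.infinite _ hρ
  have h1 := hl.infinite _ hρ1
  have hd0 := hH.logDeriv_ne_zero h0
  have hd1 := hH.logDeriv_ne_zero h1
  have hl1 := ne_zero_of_v_neg h1
  have hv := hl.v_deriv_succ hL hρ
  have hdd : (l (ρ + 1))′ = Differential.logDeriv (l (ρ + 1)) * l (ρ + 1) := by
    rw [Differential.logDeriv, div_mul_cancel₀ _ hl1]
  have hu0 : (l (ρ + 1))′ ≠ 0 := by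
    rw [hdd]
    exact mul_ne_zero hd1 hl1
  have hu : v ((l (ρ + 1))′ / Differential.logDeriv (l ρ)) = 0 := by
    refine le_antisymm ?_ ((v_le_v_iff_div hd0).1 hv.ge)
    by_contra! h5
    exact ((v_lt_v_iff_div hd0).2 h5).ne hv.symm
  have h3 := hH.v_logDeriv_lt_v_logDeriv_of_eq_zero h1 hu
  have h4 : lam l (ρ + 1) - lam l ρ =
      Differential.logDeriv (l (ρ + 1)) -
        Differential.logDeriv ((l (ρ + 1))′ / Differential.logDeriv (l ρ)) := by
    rw [Differential.logDeriv_div _ _ hu0 hd0, hdd, Differential.logDeriv_mul _ _ hd1 hl1, lam, lam]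
    ring
  rw [h4, AddValuation.map_sub_eq_of_lt_left v h3]

/-- Only the first step counts: `λ_σ - λ_{ρ+1} = -(ℓ_σ†/ℓ_{ρ+1}†)†` is dominated by `ℓ_{ρ+1}†`. -/
lemma v_lam_sub {ρ σ : Ordinal.{u}} (hρσ : ρ < σ) (hσ : σ < ν) :
    v (lam l σ - lam l ρ) = v (Differential.logDeriv (l (ρ + 1))) := by
  have hρ := hρσ.trans hσ
  rcases (Order.add_one_le_iff.2 hρσ).lt_or_eq with h | rfl
  · have hρ1 := hl.add_one_lt hρ
    have hd1 := hH.logDeriv_ne_zero (hl.infinite _ hρ1)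
    have h1 := hH.v_lt_v_logDeriv_div (hl.infinite σ hσ) hd1
      (hl.v_logDeriv_strictMono hH hL h hσ)
    rw [Differential.logDeriv_div _ _ (hH.logDeriv_ne_zero (hl.infinite σ hσ)) hd1,
      ← hl.v_lam_succ_sub hH hL hρ] at h1
    have h2 : lam l σ - lam l ρ = (lam l (ρ + 1) - lam l ρ) -
        (Differential.logDeriv (Differential.logDeriv (l σ)) -
          Differential.logDeriv (Differential.logDeriv (l (ρ + 1)))) := by
      simp only [lam]
      ring
    rw [h2, AddValuation.map_sub_eq_of_lt_left v h1, hl.v_lam_succ_sub hH hL hρ]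
  · exact hl.v_lam_succ_sub hH hL hρ

lemma isPCSequence_lam : IsPCSequence ν (lam l) := by
  refine ⟨0, hl.isSuccLimit.bot_lt, fun ρ σ τ _ hρσ hστ hτ => ?_⟩
  have hσ := hστ.trans hτ
  rw [hl.v_lam_sub hH hL hρσ hσ, hl.v_lam_sub hH hL hστ hτ]
  exact hl.v_logDeriv_strictMono hH hL (by simpa using hρσ) (hl.add_one_lt hσ)

lemma isJammed_lam : IsJammed ν (lam l) := by
  intro δ hδ hδt
  obtain ⟨ε, rfl⟩ : ∃ ε : K, v ε = δ := (ring K).valuation_surjective δ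
  have hε : ε ≠ 0 := by
    rintro rfl
    simp at hδt
  -- Past `ρ₀` all `ℓ_ρ ≼ ε⁻¹`, so `v(ε†) ≤ v(ℓ_{ρ+1}†)`, while `v(ℓ_{μ+1}†) < v(ε′) = v(ε†) + δ`.
  obtain ⟨ρ₀, hρ₀, h⟩ := hl.exists_v_le (v_inv_neg hε hδ)
  refine ⟨ρ₀, hρ₀, fun ρ μ h1 h2 h3 => ?_⟩
  have hρ := h2.trans h3
  have hμ1 := hl.add_one_lt h3
  have hρ1 := hl.add_one_lt hρ
  rw [hl.v_lam_succ_sub hH hL hρ, hl.v_lam_succ_sub hH hL h3]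
  have h4 : v (Differential.logDeriv ε) ≤ v (Differential.logDeriv (l (ρ + 1))) := by
    have := hH.v_logDeriv_mono (hl.infinite _ hρ1)
      (h.trans (hl.v_mono hH hL (h1.le.trans le_self_add) hρ1))
    rwa [logDeriv_inv, AddValuation.map_neg] at this
  constructor
  · refine (hH.v_logDeriv_lt_v_deriv (hl.infinite _ hμ1) hδ).trans_le ?_
    rw [← v_logDeriv_add hε]
    exact add_le_add_left h4 _
  · exact (hl.v_logDeriv_strictMono hH hL (by simpa using h2) hμ1).trans_le
      (le_add_of_nonneg_right hδ.le)

lemma v_sub_lam_of_isPseudolimit {x : K} (hx : IsPseudolimit ν (lam l) x) :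
    ∃ ρ₀ < ν, ∀ ρ, ρ₀ < ρ → ρ < ν → v (x - lam l ρ) = v (Differential.logDeriv (l (ρ + 1))) := by
  obtain ⟨ρ₀, hρ₀, h⟩ := hx
  refine ⟨ρ₀, hρ₀, fun ρ h1 h2 => ?_⟩
  have h3 := h ρ (ρ + 1) h1 (Order.lt_add_one_iff.2 le_rfl) (hl.add_one_lt h2)
  rw [← hl.v_lam_succ_sub hH hL h2, ← AddValuation.map_sub_eq_of_lt_left v h3]
  congr 1
  ring

/-- The sequence `(λ_ρ)` has no pseudolimit iff every element is approximated badly by logarithmic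
derivatives. -/
lemma forall_exists_iff_not_isPseudolimit (hK : HasAsymptoticIntegration K) :
    (∀ a : K, ∃ b : K, b ≠ 0 ∧ v (a - Differential.logDeriv b) ≤ v b ∧ ∀ γ ∈ derivPos K, v b < γ) ↔
      ¬ ∃ x : K, IsPseudolimit ν (lam l) x := by
  constructor
  · rintro h ⟨x, hx⟩
    obtain ⟨b, hb, hab, hγ⟩ := h (-x)
    obtain ⟨g, hg, hgb⟩ := IsHField.exists_v_eq_v_deriv hK hb hγ
    obtain ⟨ρ₁, hρ₁, h1⟩ := hl.exists_v_le hg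
    obtain ⟨ρ₂, hρ₂, h2⟩ := hl.v_sub_lam_of_isPseudolimit hH hL hx
    -- The bound `ρ₁` ensures `ℓ_ρ ≼ g`, hence `b ≍ g′ ≻ g† ≽ ℓ_ρ†`; exceeding `ρ₂` makes `x - λ_ρ ≍
    -- ℓ_{ρ+1}†`.
    set ρ := max ρ₁ ρ₂ + 1
    have hρ : ρ < ν := hl.add_one_lt (max_lt hρ₁ hρ₂)
    have hlρ := hl.infinite ρ hρ
    have hgt : v b < v (Differential.logDeriv (l ρ)) := by
      rw [← hgb]
      refine (hH.v_deriv_lt_v_logDeriv hg).trans_le (hH.v_logDeriv_mono hlρ ?_)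
      exact h1.trans (hl.v_mono hH hL ((le_max_left _ _).trans le_self_add) hρ)
    have h3 := hH.v_lt_v_logDeriv_div hlρ hb hgt
    rw [Differential.logDeriv_div _ _ (hH.logDeriv_ne_zero hlρ) hb] at h3
    have h4 : v b < v (x - lam l ρ) := by
      rw [h2 ρ (Order.lt_add_one_iff.2 (le_max_right _ _)) hρ]
      exact hgt.trans (hl.v_logDeriv_strictMono hH hL (Order.lt_add_one_iff.2 le_rfl)
        (hl.add_one_lt hρ))
    have h5 : -x - Differential.logDeriv b =
        (Differential.logDeriv (Differential.logDeriv (l ρ)) - Differential.logDeriv b) + -(x - lam l ρ) := by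
      simp only [lam]
      ring
    refine hab.not_gt ?_
    rw [h5]
    exact AddValuation.map_lt_add v h3 (by rwa [AddValuation.map_neg])
  · intro h a
    by_contra! hcon
    refine h ⟨-a, 0, hl.isSuccLimit.bot_lt, fun ρ σ _ hρσ hσ => ?_⟩
    -- The failing condition is tested on `b = ℓ_ρ†`, whose valuation always lies below `(Γ^>)'`.
    have h1 (ρ : Ordinal.{u}) (hρ : ρ < ν) : v (Differential.logDeriv (l ρ)) < v (-a - lam l ρ) := by
      have hlρ := hl.infinite ρ hρ
      by_contra! h2
      obtain ⟨γ, hγ, h3⟩ := hcon _ (hH.logDeriv_ne_zero hlρ) (by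
        rwa [← AddValuation.map_neg, show -(a - Differential.logDeriv (Differential.logDeriv (l ρ))) = -a - lam l ρ by
          simp only [lam]; ring])
      exact h3.not_gt (hH.v_logDeriv_lt_of_mem_derivPos hlρ hγ)
    have h2 (ρ : Ordinal.{u}) (hρ : ρ < ν) :
        v (-a - lam l ρ) = v (Differential.logDeriv (l (ρ + 1))) := by
      -- At index `ρ + 1` the bound says `-a - λ_{ρ+1} ≺ λ_{ρ+1} - λ_ρ`, which turns the inequality
      -- at `ρ` into an exact valuation.
      have h3 := h1 _ (hl.add_one_lt hρ)
      rw [← hl.v_lam_succ_sub hH hL hρ] at h3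
      rw [← hl.v_lam_succ_sub hH hL hρ, ← AddValuation.map_add_eq_of_lt_left v h3]
      congr 1
      ring
    rw [h2 ρ (hρσ.trans hσ), h2 σ hσ]
    exact hl.v_logDeriv_strictMono hH hL (by simpa using hρσ) (hl.add_one_lt hσ)

end IsLogSequence

end Valuation

end HField

theorem mainTheorem5 {K : Type u} [Field K] [LinearOrder K] [IsStrictOrderedRing K]
    [Differential K] [IsRealClosed K] (hH : HField.IsHField K)
    (hK : HField.HasAsymptoticIntegration K) :
    (∃ (L : K → K) (ν : Ordinal.{u}) (l : Ordinal.{u} → K),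
      HField.IsLogSubstitute L ∧ HField.IsLogSequence L ν l) ∧
    ∀ (L : K → K) (ν : Ordinal.{u}) (l : Ordinal.{u} → K),
      HField.IsLogSubstitute L → HField.IsLogSequence L ν l →
      (HField.IsPCSequence ν (HField.lam l) ∧ HField.IsJammed ν (HField.lam l)) ∧
      ((∀ a : K, ∃ b : K, b ≠ 0 ∧
          HField.v (a - Differential.logDeriv b) ≤ HField.v b ∧
          ∀ γ ∈ HField.derivPos K, HField.v b < γ) ↔
        ¬ ∃ x : K, HField.IsPseudolimit ν (HField.lam l) x) := by
  refine ⟨?_, fun L ν l hL hl => ⟨⟨hl.isPCSequence_lam hH hL, hl.isJammed_lam hH hL⟩,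
    hl.forall_exists_iff_not_isPseudolimit hH hL hK⟩⟩
  obtain ⟨L, hL⟩ := hH.exists_isLogSubstitute hK
  obtain ⟨f, hf⟩ := HField.exists_v_neg hK
  obtain ⟨ν, hν⟩ := HField.exists_isLogSequence hH hL hf
  exact ⟨L, ν, _, hL, hν⟩
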